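/- A ring $B$ is semi-graded if it comes with additive subgroups $B_n$ ($n\ge 0$) such that $B=\bigoplus_{n\ge 0}B_n$, $B_mB_n\subseteq B_0\oplus\cdots\oplus B_{m+n}$ and $1\in B_0$. A left $B$-module $M$ is semi-graded if it comes with additive subgroups $M_n$ ($n\in\mathbb Z$) such that $M=\bigoplus_{n\in\mathbb Z}M_n$ and $B_mM_n\subseteq\bigoplus_{k\le m+n}M_k$; a $B$-homomorphism $f:M\to N$ is homogeneous if $f(M_n)\subseteq N_n$ for all $n$. Let $B$ be a left noetherian semi-graded ring and let $\mathrm{sgr}\text{-}B$ be the abelian category of finitely generated semi-graded left $B$-modules and homogeneous $B$-homomorphisms. For $s\ge 0$ let $B_{\ge s}$ be the least two-sided ideal $I$ of $B$ that contains $\bigoplus_{p\ge s}B_p$, is semi-graded as a left ideal (i.e. $I=\bigoplus_n (I\cap B_n)$) and is a direct summand of the additive group of $B$ (if there is no least such ideal, $B_{\ge s}$ denotes the intersection of all of them). An element $x$ of an object $M$ of $\mathrm{sgr}\text{-}B$ is torsion if $B_{\ge s}^{\,n}x=0$ for some $s,n\ge 0$, and $M$ is torsion if all its elements are torsion. Then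 the collection $\mathrm{stor}\text{-}B$ of torsion modules is a Serre subcategory of $\mathrm{sgr}\text{-}B$, and the quotient category $\mathrm{qsgr}\text{-}B:=\mathrm{sgr}\text{-}B/\mathrm{stor}\text{-}B$ is abelian, with additive quotient functor $\pi$. Here $\mathrm{qsgr}\text{-}B$ is the localization of $\mathrm{sgr}\text{-}B$ at the morphisms with torsion kernel and cokernel; its objects are those of $\mathrm{sgr}\text{-}B$, and $$\mathrm{Hom}_{\mathrm{qsgr}\text{-}B}(M,N)=\varinjlim \mathrm{Hom}_{\mathrm{sgr}\text{-}B}(M',N/N'),$$ the direct limit being over the pairs $M'\subseteq M$, $N'\subseteq N$ in $\mathrm{sgr}\text{-}B$ with $M/M'$ and $N'$ torsion. In particular the underlying category of the semi-projective scheme $\mathrm{sproj}(B):=(\mathrm{qsgr}\text{-}B,\pi(B))$ is abelian. -/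

import Mathlib

open CategoryTheory CategoryTheory.Limits

universe u

/-! ### Semi-graded rings and modules -/

/-- `𝓑` is a semi-graduation of the ring `B`: `B = ⨁ₙ Bₙ` as an additive group,
`Bₘ Bₙ ⊆ B₀ ⊕ ⋯ ⊕ Bₘ₊ₙ` and `1 ∈ B₀`. -/
class SemiGradedRing {B : Type u} [Ring B] (𝓑 : ℕ → AddSubgroup B) : Prop where
  isInternal : DirectSum.IsInternal 𝓑
  mul_mem : ∀ {m n : ℕ} {a b : B}, a ∈ 𝓑 m → b ∈ 𝓑 n → a * b ∈ ⨆ k ≤ m + n, 𝓑 k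
  one_mem : (1 : B) ∈ 𝓑 0

/-- `ℳ` is a (`ℤ`-indexed) semi-graduation of the left `B`-module `M`: `M = ⨁ₙ Mₙ` as an
additive group and `Bₘ Mₙ ⊆ ⨁_{k ≤ m + n} Mₖ`. -/
structure IsSemiGraduation {B : Type u} [Ring B] (𝓑 : ℕ → AddSubgroup B)
    {M : Type u} [AddCommGroup M] [Module B M] (ℳ : ℤ → AddSubgroup M) : Prop where
  isInternal : DirectSum.IsInternal ℳ
  smul_mem : ∀ {m : ℕ} {n : ℤ} {a : B} {x : M}, a ∈ 𝓑 m → x ∈ ℳ n →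
    a • x ∈ ⨆ k ≤ (m : ℤ) + n, ℳ k

/-- An additive subgroup `N` of `M = ⨁ᵢ Mᵢ` is semi-graded if `N = ⨁ᵢ (N ∩ Mᵢ)`
(the sum on the right is always direct). -/
def IsSemiGradedSub {ι : Type} {M : Type u} [AddCommGroup M] (ℳ : ι → AddSubgroup M)
    (N : AddSubgroup M) : Prop :=
  N = ⨆ i, N ⊓ ℳ i

/-! ### Homogeneous components -/

section Components

variable {ι : Type} [DecidableEq ι] {M : Type u} [AddCommGroup M] {ℳ : ι → AddSubgroup M}

/-- The homogeneous component of degree `i`, as an additive map. -/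
noncomputable def homComp (h : DirectSum.IsInternal ℳ) (i : ι) : M →+ M :=
  ((ℳ i).subtype.comp (DFinsupp.evalAddMonoidHom i)).comp
    (AddEquiv.ofBijective (DirectSum.coeAddMonoidHom ℳ) h).symm.toAddMonoidHom

theorem homComp_mem (h : DirectSum.IsInternal ℳ) (i : ι) (x : M) : homComp h i x ∈ ℳ i :=
  SetLike.coe_mem _

theorem homComp_of_mem (h : DirectSum.IsInternal ℳ) {i j : ι} {x : M} (hx : x ∈ ℳ i) :
    homComp h j x = if i = j then x else 0 := by
  have : (AddEquiv.ofBijective (DirectSum.coeAddMonoidHom ℳ) h).symm x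
      = DirectSum.of (fun i => ℳ i) i ⟨x, hx⟩ := by
    rw [AddEquiv.symm_apply_eq]
    exact (DirectSum.coeAddMonoidHom_of ℳ i ⟨x, hx⟩).symm
  have h2 : homComp h j x = ((DirectSum.of (fun i => ℳ i) i ⟨x, hx⟩) j : ℳ j) := by
    rw [← this]; rfl
  rw [h2, DirectSum.coe_of_apply]
  split_ifs <;> rfl

theorem homComp_sum (h : DirectSum.IsInternal ℳ) (x : M) :
    ∃ s : Finset ι, x = ∑ i ∈ s, homComp h i x := by
  classical
  set e := AddEquiv.ofBijective (DirectSum.coeAddMonoidHom ℳ) h with he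
  refine ⟨DFinsupp.support (e.symm x), ?_⟩
  have h1 : x = e (e.symm x) := (e.apply_symm_apply x).symm
  have h2 : e (e.symm x) = ∑ i ∈ DFinsupp.support (e.symm x), ((e.symm x) i : M) := by
    change DirectSum.coeAddMonoidHom ℳ (e.symm x) = _
    rw [DirectSum.coeAddMonoidHom_eq_dfinsuppSum]
    rfl
  exact h1.trans h2

theorem iSup_eq_top_of_isInternal (h : DirectSum.IsInternal ℳ) : iSup ℳ = ⊤ := by
  rw [eq_top_iff]
  intro x _
  obtain ⟨s, hs⟩ := homComp_sum h x
  rw [hs]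
  exact sum_mem fun i _ => AddSubgroup.mem_iSup_of_mem i (homComp_mem h i x)

/-- A family of subgroups that spans and has component maps is a direct sum decomposition. -/
theorem isInternal_of_comp (p : ι → M →+ M)
    (hp : ∀ {i j : ι} {x : M}, x ∈ ℳ i → p j x = if i = j then x else 0)
    (htop : iSup ℳ = ⊤) : DirectSum.IsInternal ℳ := by
  have key : ∀ (d : DirectSum ι fun i => ℳ i) (j : ι),
      p j (DirectSum.coeAddMonoidHom ℳ d) = (d j : M) := by
    intro d j
    induction d using DirectSum.induction_on with
    | zero => simp
    | of i x => rw [DirectSum.coeAddMonoidHom_of, hp x.2, DirectSum.coe_of_apply]; split_ifs <;> rfl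
    | add a b ha hb => rw [map_add, map_add, ha, hb]; rfl
  constructor
  · rw [injective_iff_map_eq_zero]
    intro d hd
    ext j
    rw [← key d j, hd, map_zero]; rfl
  · intro x
    have hx : x ∈ iSup ℳ := htop ▸ AddSubgroup.mem_top x
    have hle : iSup ℳ ≤ (DirectSum.coeAddMonoidHom ℳ).range := iSup_le fun i y hy =>
      ⟨DirectSum.of (fun i => ℳ i) i ⟨y, hy⟩, DirectSum.coeAddMonoidHom_of ℳ i ⟨y, hy⟩⟩
    exact hle hx

theorem mem_iSup_le_iff {ℳ : ℤ → AddSubgroup M} (h : DirectSum.IsInternal ℳ) {N : ℤ} {x : M} :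
    x ∈ ⨆ k ≤ N, ℳ k ↔ ∀ j, N < j → homComp h j x = 0 := by
  constructor
  · intro hx j hj
    have hle : (⨆ k ≤ N, ℳ k) ≤ (homComp h j).ker := iSup₂_le fun k hk y hy => by
      rw [AddMonoidHom.mem_ker, homComp_of_mem h hy, if_neg (by omega)]
    exact hle hx
  · intro hx
    obtain ⟨s, hs⟩ := homComp_sum h x
    rw [hs]
    refine sum_mem fun i _ => ?_
    by_cases hi : i ≤ N
    · exact AddSubgroup.mem_iSup_of_mem i (AddSubgroup.mem_iSup_of_mem hi (homComp_mem h i x))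
    · rw [hx i (by omega)]; exact zero_mem _

end Components

/-! ### The category of finitely generated semi-graded modules -/

section Category

variable {B : Type u} [Ring B]

/-- The objects of `sgr-B`: finitely generated left `B`-modules with a semi-graduation. -/
structure SGr (𝓑 : ℕ → AddSubgroup B) : Type (u + 1) where
  carrier : Type u
  [addCommGroup : AddCommGroup carrier]
  [module : Module B carrier]
  /-- the homogeneous component of degree `n` -/
  gr : ℤ → AddSubgroup carrier
  semiGraded : IsSemiGraduation 𝓑 gr
  finite : Module.Finite B carrier

namespace SGr

variable {𝓑 : ℕ → AddSubgroup B}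

instance : CoeSort (SGr 𝓑) (Type u) := ⟨SGr.carrier⟩

attribute [instance] SGr.addCommGroup SGr.module SGr.finite

/-- The morphisms of `sgr-B`: homogeneous `B`-homomorphisms. -/
@[ext]
structure Hom (M N : SGr 𝓑) where
  lin : M →ₗ[B] N
  map_mem : ∀ {n : ℤ} {x : M}, x ∈ M.gr n → lin x ∈ N.gr n

instance : Category.{u} (SGr 𝓑) where
  Hom M N := Hom M N
  id M := ⟨LinearMap.id, fun h => h⟩
  comp f g := ⟨g.lin ∘ₗ f.lin, fun h => g.map_mem (f.map_mem h)⟩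

@[ext]
theorem hom_ext {M N : SGr 𝓑} {f g : M ⟶ N} (h : ∀ x, Hom.lin f x = Hom.lin g x) : f = g :=
  Hom.ext (LinearMap.ext h)

@[simp] theorem id_lin (M : SGr 𝓑) : Hom.lin (𝟙 M) = LinearMap.id := rfl

@[simp] theorem comp_lin {M N P : SGr 𝓑} (f : M ⟶ N) (g : N ⟶ P) :
    Hom.lin (f ≫ g) = Hom.lin g ∘ₗ Hom.lin f := rfl

instance {M N : SGr 𝓑} : Zero (M ⟶ N) := ⟨⟨0, fun _ => zero_mem _⟩⟩

instance {M N : SGr 𝓑} : Add (M ⟶ N) :=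
  ⟨fun f g => ⟨Hom.lin f + Hom.lin g, fun h => add_mem (Hom.map_mem f h) (Hom.map_mem g h)⟩⟩

instance {M N : SGr 𝓑} : Neg (M ⟶ N) :=
  ⟨fun f => ⟨-Hom.lin f, fun h => neg_mem (Hom.map_mem f h)⟩⟩

@[simp] theorem zero_lin {M N : SGr 𝓑} : Hom.lin (0 : M ⟶ N) = 0 := rfl

@[simp] theorem add_lin {M N : SGr 𝓑} (f g : M ⟶ N) :
    Hom.lin (f + g) = Hom.lin f + Hom.lin g := rfl

@[simp] theorem neg_lin {M N : SGr 𝓑} (f : M ⟶ N) : Hom.lin (-f) = -Hom.lin f := rfl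

instance {M N : SGr 𝓑} : AddCommGroup (M ⟶ N) where
  add_assoc f g h := by ext x; simp [add_assoc]
  zero_add f := by ext x; simp
  add_zero f := by ext x; simp
  add_comm f g := by ext x; simp [add_comm]
  neg_add_cancel f := by ext x; simp
  nsmul := nsmulRec
  zsmul := zsmulRec

/-- Morphisms are added pointwise. -/
instance : Preadditive (SGr 𝓑) where
  homGroup _ _ := inferInstance
  add_comp _ _ _ f g h := by ext x; simp
  comp_add _ _ _ f g h := by ext x; simp

/-- The homogeneous component of degree `n` of an element of a semi-graded module. -/
noncomputable def comp (M : SGr 𝓑) (n : ℤ) : M →+ M := homComp M.semiGraded.isInternal n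

theorem comp_mem (M : SGr 𝓑) (n : ℤ) (x : M) : M.comp n x ∈ M.gr n := homComp_mem _ n x

theorem comp_of_mem (M : SGr 𝓑) {i j : ℤ} {x : M} (hx : x ∈ M.gr i) :
    M.comp j x = if i = j then x else 0 := homComp_of_mem _ hx

theorem comp_sum (M : SGr 𝓑) (x : M) : ∃ s : Finset ℤ, x = ∑ i ∈ s, M.comp i x :=
  homComp_sum _ x

theorem lin_comp {M N : SGr 𝓑} (f : M ⟶ N) (n : ℤ) (x : M) :
    Hom.lin f (M.comp n x) = N.comp n (Hom.lin f x) := by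
  have hx : x ∈ iSup M.gr :=
    iSup_eq_top_of_isInternal M.semiGraded.isInternal ▸ AddSubgroup.mem_top x
  induction hx using AddSubgroup.iSup_induction' with
  | hp i y hy =>
    rw [M.comp_of_mem hy, N.comp_of_mem (Hom.map_mem f hy)]
    split_ifs <;> simp
  | h1 => simp
  | hadd y z _ _ hy hz => simp only [map_add, hy, hz]

theorem comp_smul_eq_zero (M : SGr 𝓑) {m : ℕ} {n j : ℤ} {a : B} {x : M} (ha : a ∈ 𝓑 m)
    (hx : x ∈ M.gr n) (hj : (m : ℤ) + n < j) : M.comp j (a • x) = 0 :=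
  (mem_iSup_le_iff M.semiGraded.isInternal).1 (M.semiGraded.smul_mem ha hx) j hj

/-- Constructing a semi-graduation from component maps. -/
theorem isSemiGraduation_of_comp {M : Type u} [AddCommGroup M] [Module B M]
    {ℳ : ℤ → AddSubgroup M} (p : ℤ → M →+ M)
    (hp : ∀ {i j : ℤ} {x : M}, x ∈ ℳ i → p j x = if i = j then x else 0)
    (htop : iSup ℳ = ⊤)
    (hsmul : ∀ {m : ℕ} {n j : ℤ} {a : B} {x : M}, a ∈ 𝓑 m → x ∈ ℳ n → (m : ℤ) + n < j →
      p j (a • x) = 0) : IsSemiGraduation 𝓑 ℳ := by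
  have hI := isInternal_of_comp p hp htop
  refine ⟨hI, fun {m n a x} ha hx => (mem_iSup_le_iff hI).2 fun j hj => ?_⟩
  rw [← hsmul ha hx hj]
  have key : ∀ y : M, homComp hI j y = p j y := by
    intro y
    have hy : y ∈ iSup ℳ := htop ▸ AddSubgroup.mem_top y
    induction hy using AddSubgroup.iSup_induction' with
    | hp i y hy => rw [homComp_of_mem hI hy, hp hy]
    | h1 => simp
    | hadd y z _ _ hy hz => rw [map_add, map_add, hy, hz]
  exact key _

/-- A submodule closed under taking homogeneous components, as an object of `sgr-B`. -/
def sub [IsNoetherianRing B] (M : SGr 𝓑) (K : Submodule B M)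
    (hK : ∀ n, ∀ x ∈ K, M.comp n x ∈ K) : SGr 𝓑 where
  carrier := K
  gr n := (M.gr n).comap K.subtype.toAddMonoidHom
  semiGraded := by
    refine isSemiGraduation_of_comp
      (fun n => ((M.comp n).comp K.subtype.toAddMonoidHom).codRestrict K fun x => hK n x x.2)
      ?_ ?_ ?_
    · intro i j x hx
      apply Subtype.ext
      refine (M.comp_of_mem hx).trans ?_
      split_ifs <;> rfl
    · rw [eq_top_iff]
      intro x _
      obtain ⟨s, hs⟩ := M.comp_sum x.1
      have : x = ∑ i ∈ s, (⟨M.comp i x.1, hK i _ x.2⟩ : K) := by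
        apply Subtype.ext
        rw [AddSubmonoidClass.coe_finsetSum]
        exact hs
      rw [this]
      exact sum_mem fun i _ => AddSubgroup.mem_iSup_of_mem i (M.comp_mem i x.1)
    · intro m n j a x ha hx hj
      apply Subtype.ext
      exact M.comp_smul_eq_zero ha hx hj
  finite := inferInstance

/-- The quotient by a submodule closed under taking homogeneous components. -/
def quot (M : SGr 𝓑) (K : Submodule B M) (hK : ∀ n, ∀ x ∈ K, M.comp n x ∈ K) : SGr 𝓑 where
  carrier := M ⧸ K
  gr n := (M.gr n).map K.mkQ.toAddMonoidHom
  semiGraded := by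
    refine isSemiGraduation_of_comp
      (fun n => QuotientAddGroup.lift K.toAddSubgroup
        (K.mkQ.toAddMonoidHom.comp (M.comp n)) fun x hx => ?_) ?_ ?_ ?_
    · exact (Submodule.Quotient.mk_eq_zero K).2 (hK n x hx)
    · rintro i j _ ⟨x, hx, rfl⟩
      change K.mkQ (M.comp j x) = _
      rw [M.comp_of_mem hx]
      split_ifs
      · rfl
      · exact map_zero _
    · rw [eq_top_iff]
      intro y _
      obtain ⟨x, rfl⟩ := K.mkQ_surjective y
      obtain ⟨s, hs⟩ := M.comp_sum x
      rw [hs, map_sum]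
      exact sum_mem fun i _ => AddSubgroup.mem_iSup_of_mem i ⟨_, M.comp_mem i x, rfl⟩
    · rintro m n j a _ ha ⟨x, hx, rfl⟩ hj
      change K.mkQ (M.comp j (a • x)) = 0
      rw [M.comp_smul_eq_zero ha hx hj, map_zero]
  finite := inferInstance

/-- The direct sum of two semi-graded modules. -/
def prod (M N : SGr 𝓑) : SGr 𝓑 where
  carrier := M × N
  gr n := (M.gr n).prod (N.gr n)
  semiGraded := by
    refine isSemiGraduation_of_comp (fun n => (M.comp n).prodMap (N.comp n)) ?_ ?_ ?_
    · rintro i j ⟨x, y⟩ ⟨hx, hy⟩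
      refine Prod.ext ((M.comp_of_mem hx).trans ?_) ((N.comp_of_mem hy).trans ?_) <;>
        split_ifs <;> rfl
    · rw [eq_top_iff]
      rintro ⟨x, y⟩ _
      obtain ⟨s, hs⟩ := M.comp_sum x
      obtain ⟨t, ht⟩ := N.comp_sum y
      have h : ((x, y) : M × N) = AddMonoidHom.inl M N x + AddMonoidHom.inr M N y := by simp
      rw [h, hs, ht, map_sum, map_sum]
      refine add_mem (sum_mem fun i _ => AddSubgroup.mem_iSup_of_mem i ?_)
        (sum_mem fun i _ => AddSubgroup.mem_iSup_of_mem i ?_)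
      · exact ⟨M.comp_mem i x, zero_mem _⟩
      · exact ⟨zero_mem _, N.comp_mem i y⟩
    · rintro m n j a ⟨x, y⟩ ha ⟨hx, hy⟩ hj
      exact Prod.ext (M.comp_smul_eq_zero ha hx hj) (N.comp_smul_eq_zero ha hy hj)
  finite := inferInstance

/-- The zero module. -/
def zeroObj (𝓑 : ℕ → AddSubgroup B) : SGr 𝓑 where
  carrier := PUnit
  gr _ := ⊤
  semiGraded := by
    refine isSemiGraduation_of_comp (fun _ => 0) ?_ ?_ ?_
    · intros; exact Subsingleton.elim _ _
    · simp
    · intros; rfl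
  finite := inferInstance

/-- Factorization through an injective homogeneous map. -/
theorem exists_lift {A S N : SGr 𝓑} (f : A ⟶ N) (hf : Function.Injective (Hom.lin f))
    (s : S ⟶ N) (h : ∀ x, ∃ a, Hom.lin f a = Hom.lin s x) : ∃ l : S ⟶ A, l ≫ f = s := by
  choose g hg using h
  refine ⟨⟨⟨⟨g, fun x y => hf ?_⟩, fun a x => hf ?_⟩, fun {n x} hx => ?_⟩, ?_⟩
  · simp [hg]
  · simp [hg]
  · have h1 : A.comp n (g x) = g x := hf (by
      rw [lin_comp, hg, N.comp_of_mem (Hom.map_mem s hx), if_pos rfl])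
    change g x ∈ _
    rw [← h1]
    exact A.comp_mem n _
  · ext x; exact hg x

/-- Factorization through a surjective homogeneous map. -/
theorem exists_desc {M Q T : SGr 𝓑} (q : M ⟶ Q) (hq : Function.Surjective (Hom.lin q))
    (t : M ⟶ T) (h : ∀ x, Hom.lin q x = 0 → Hom.lin t x = 0) : ∃ l : Q ⟶ T, q ≫ l = t := by
  have h' : ∀ x y, Hom.lin q x = Hom.lin q y → Hom.lin t x = Hom.lin t y := fun x y hxy => by
    rw [← sub_eq_zero, ← map_sub]
    exact h _ (by rw [map_sub, hxy, sub_self])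
  choose g hg using hq
  have key : ∀ x, Hom.lin t (g (Hom.lin q x)) = Hom.lin t x := fun x => h' _ _ (hg _)
  refine ⟨⟨⟨⟨fun y => Hom.lin t (g y), fun x y => ?_⟩, fun a x => ?_⟩,
    fun {n y} hy => ?_⟩, ?_⟩
  · rw [← map_add]; exact h' _ _ (by simp [hg])
  · rw [← map_smul]; exact h' _ _ (by simp [hg])
  · have h1 : Hom.lin t (M.comp n (g y)) = Hom.lin t (g y) := h' _ _ (by
      rw [lin_comp, hg, Q.comp_of_mem hy, if_pos rfl])
    change Hom.lin t (g y) ∈ _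
    rw [← h1]
    exact Hom.map_mem t (M.comp_mem n _)
  · ext x; exact key x

theorem mono_of_injective {M N : SGr 𝓑} (f : M ⟶ N) (hf : Function.Injective (Hom.lin f)) :
    Mono f :=
  ⟨fun g h e => by ext x; exact hf (LinearMap.congr_fun (congrArg Hom.lin e) x)⟩

theorem epi_of_surjective {M N : SGr 𝓑} (f : M ⟶ N) (hf : Function.Surjective (Hom.lin f)) :
    Epi f :=
  ⟨fun g h e => by
    ext x
    obtain ⟨y, rfl⟩ := hf x
    exact LinearMap.congr_fun (congrArg Hom.lin e) y⟩

/-- The cokernel of a homogeneous homomorphism, as an object of `sgr-B`. -/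
def coker {M N : SGr 𝓑} (f : M ⟶ N) : SGr 𝓑 :=
  N.quot (LinearMap.range (Hom.lin f)) (by
    rintro n _ ⟨x, rfl⟩
    exact ⟨M.comp n x, lin_comp f n x⟩)

/-- The projection to the cokernel. -/
def cokerπ {M N : SGr 𝓑} (f : M ⟶ N) : N ⟶ coker f :=
  ⟨(LinearMap.range (Hom.lin f)).mkQ, fun h => ⟨_, h, rfl⟩⟩

theorem cokerπ_surjective {M N : SGr 𝓑} (f : M ⟶ N) :
    Function.Surjective (Hom.lin (cokerπ f)) :=
  Submodule.mkQ_surjective _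

theorem cokerπ_eq_zero_iff {M N : SGr 𝓑} (f : M ⟶ N) (y : N) :
    Hom.lin (cokerπ f) y = 0 ↔ ∃ x, Hom.lin f x = y :=
  Submodule.Quotient.mk_eq_zero _

theorem comp_cokerπ {M N : SGr 𝓑} (f : M ⟶ N) : f ≫ cokerπ f = 0 := by
  ext x; exact (cokerπ_eq_zero_iff f _).2 ⟨x, rfl⟩

/-- An injective map which is the set-theoretic kernel of `g` is a categorical kernel of `g`. -/
theorem nonempty_isLimit {A M N : SGr 𝓑} (i : A ⟶ M) (g : M ⟶ N)
    (hi : Function.Injective (Hom.lin i)) (w : i ≫ g = 0)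
    (h : ∀ x, Hom.lin g x = 0 → ∃ a, Hom.lin i a = x) :
    Nonempty (IsLimit (KernelFork.ofι i w)) := by
  have := mono_of_injective i hi
  have hl : ∀ (s : KernelFork g), ∃ l : s.pt ⟶ A, l ≫ i = s.ι := fun s =>
    exists_lift i hi s.ι fun x => h _ (LinearMap.congr_fun (congrArg Hom.lin s.condition) x)
  choose l hl using hl
  exact ⟨Fork.IsLimit.mk _ l hl fun s m hm => by
    rw [← cancel_mono i]
    exact hm.trans (hl s).symm⟩

/-- A surjective map with set-theoretic kernel the range of `g` is a categorical cokernel. -/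
theorem nonempty_isColimit {M N Q : SGr 𝓑} (g : M ⟶ N) (q : N ⟶ Q)
    (hq : Function.Surjective (Hom.lin q)) (w : g ≫ q = 0)
    (h : ∀ y, Hom.lin q y = 0 → ∃ x, Hom.lin g x = y) :
    Nonempty (IsColimit (CokernelCofork.ofπ q w)) := by
  have := epi_of_surjective q hq
  have hl : ∀ (s : CokernelCofork g), ∃ l : Q ⟶ s.pt, q ≫ l = s.π := fun s =>
    exists_desc q hq s.π fun y hy => by
      obtain ⟨x, rfl⟩ := h y hy
      exact LinearMap.congr_fun (congrArg Hom.lin s.condition) x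
  choose l hl using hl
  exact ⟨Cofork.IsColimit.mk _ l hl fun s m hm => by
    rw [← cancel_epi q]
    exact hm.trans (hl s).symm⟩

theorem surjective_of_epi {M N : SGr 𝓑} (f : M ⟶ N) [Epi f] :
    Function.Surjective (Hom.lin f) := by
  intro y
  have h : cokerπ f = 0 := by rw [← cancel_epi f, comp_cokerπ, comp_zero]
  exact (cokerπ_eq_zero_iff f y).1 (LinearMap.congr_fun (congrArg Hom.lin h) y)

variable [IsNoetherianRing B]

/-- The kernel of a homogeneous homomorphism, as an object of `sgr-B`. -/
def ker {M N : SGr 𝓑} (f : M ⟶ N) : SGr 𝓑 :=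
  M.sub (LinearMap.ker (Hom.lin f)) fun n x hx => by
    rw [LinearMap.mem_ker, lin_comp, LinearMap.mem_ker.1 hx, map_zero]

/-- The inclusion of the kernel. -/
def kerι {M N : SGr 𝓑} (f : M ⟶ N) : ker f ⟶ M :=
  ⟨(LinearMap.ker (Hom.lin f)).subtype, fun h => h⟩

theorem kerι_injective {M N : SGr 𝓑} (f : M ⟶ N) : Function.Injective (Hom.lin (kerι f)) :=
  Subtype.val_injective

theorem kerι_comp {M N : SGr 𝓑} (f : M ⟶ N) : kerι f ≫ f = 0 := by
  ext x; exact x.2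

instance : HasKernels (SGr 𝓑) where
  has_limit f := by
    obtain ⟨h⟩ := nonempty_isLimit (kerι f) f (kerι_injective f) (kerι_comp f)
      fun x hx => ⟨⟨x, hx⟩, rfl⟩
    exact ⟨⟨_, h⟩⟩

instance : HasCokernels (SGr 𝓑) where
  has_colimit f := by
    obtain ⟨h⟩ := nonempty_isColimit f (cokerπ f) (cokerπ_surjective f) (comp_cokerπ f)
      fun y hy => (cokerπ_eq_zero_iff f y).1 hy
    exact ⟨⟨_, h⟩⟩

theorem injective_of_mono {M N : SGr 𝓑} (f : M ⟶ N) [Mono f] :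
    Function.Injective (Hom.lin f) := by
  rw [← LinearMap.ker_eq_bot, eq_bot_iff]
  intro x hx
  have h : kerι f = 0 := by rw [← cancel_mono f, kerι_comp, zero_comp]
  exact LinearMap.congr_fun (congrArg Hom.lin h) (⟨x, hx⟩ : LinearMap.ker (Hom.lin f))

instance : HasZeroObject (SGr 𝓑) :=
  ⟨zeroObj 𝓑, by
    rw [IsZero.iff_id_eq_zero]
    ext x; rfl⟩

instance : HasFiniteProducts (SGr 𝓑) := by
  have : HasBinaryBiproducts (SGr 𝓑) := ⟨fun M N => hasBinaryBiproduct_of_total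
    { pt := prod M N
      fst := ⟨LinearMap.fst B M N, fun h => h.1⟩
      snd := ⟨LinearMap.snd B M N, fun h => h.2⟩
      inl := ⟨LinearMap.inl B M N, fun h => ⟨h, zero_mem _⟩⟩
      inr := ⟨LinearMap.inr B M N, fun h => ⟨zero_mem _, h⟩⟩ }
    (by ext x; exact LinearMap.congr_fun (LinearMap.coprod_inl_inr ) x)⟩
  have := hasFiniteProducts_of_has_binary_and_terminal (C := SGr 𝓑)
  exact this

/-- `sgr-B` is an abelian category. -/
noncomputable instance : Abelian (SGr 𝓑) where
  normalMonoOfMono f _ := ⟨{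
    Z := coker f
    g := cokerπ f
    w := comp_cokerπ f
    isLimit := (nonempty_isLimit f (cokerπ f) (injective_of_mono f) (comp_cokerπ f)
      fun y hy => (cokerπ_eq_zero_iff f y).1 hy).some }⟩
  normalEpiOfEpi f _ := ⟨{
    W := ker f
    g := kerι f
    w := kerι_comp f
    isColimit := (nonempty_isColimit (kerι f) f (surjective_of_epi f) (kerι_comp f)
      fun y hy => ⟨⟨y, hy⟩, rfl⟩).some }⟩

end SGr

/-- The semi-graduation of `B` as a left module over itself, with `Bₙ = 0` for `n < 0`. -/
def regularGr (𝓑 : ℕ → AddSubgroup B) : ℤ → AddSubgroup B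
  | Int.ofNat k => 𝓑 k
  | Int.negSucc _ => ⊥

theorem regularGr_isSemiGraduation (𝓑 : ℕ → AddSubgroup B) [h : SemiGradedRing 𝓑] :
    IsSemiGraduation 𝓑 (regularGr 𝓑) := by
  have hle : ∀ N : ℕ, (⨆ k ≤ N, 𝓑 k) ≤ ⨆ k ≤ (N : ℤ), regularGr 𝓑 k := fun N =>
    iSup₂_le fun k hk => le_iSup₂_of_le (f := fun (k : ℤ) (_ : k ≤ (N : ℤ)) => regularGr 𝓑 k)
      (k : ℤ) (by exact_mod_cast hk) le_rfl
  refine ⟨isInternal_of_comp (fun n => match n with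
    | Int.ofNat k => homComp h.isInternal k
    | Int.negSucc _ => 0) ?_ ?_, ?_⟩
  · rintro (i | i) (j | j) x hx
    · refine (homComp_of_mem h.isInternal hx).trans ?_
      simp
    · simp
    · obtain rfl : x = 0 := hx
      simp
    · obtain rfl : x = 0 := hx
      simp
  · rw [eq_top_iff, ← iSup_eq_top_of_isInternal h.isInternal]
    exact iSup_le fun k => le_iSup (regularGr 𝓑) (k : ℤ)
  · rintro m (n | n) a x ha hx
    · have := hle _ (h.mul_mem ha hx)
      simpa using this
    · obtain rfl : x = 0 := hx
      rw [smul_zero]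
      exact zero_mem _

/-- `B` as an object of `sgr-B`. -/
def regularObj (𝓑 : ℕ → AddSubgroup B) [SemiGradedRing 𝓑] : SGr 𝓑 where
  carrier := B
  gr := regularGr 𝓑
  semiGraded := regularGr_isSemiGraduation 𝓑
  finite := inferInstance

end Category

/-! ### Torsion modules -/

section Torsion

variable {B : Type u} [Ring B]

/-- The two-sided ideals of `B` which contain `⨁_{p ≥ s} Bₚ`, are semi-graded as left ideals,
and are direct summands of (the additive group of) `B`. -/
def tailIdeals (𝓑 : ℕ → AddSubgroup B) (s : ℕ) : Set (TwoSidedIdeal B) :=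
  {I | (⨆ p ≥ s, 𝓑 p) ≤ I.asIdeal.toAddSubgroup ∧
    IsSemiGradedSub 𝓑 I.asIdeal.toAddSubgroup ∧
    ∃ L : AddSubgroup B, IsCompl I.asIdeal.toAddSubgroup L}

/-- The ideal `B_{≥ s}`: the least element of `tailIdeals 𝓑 s`, taken as the infimum. -/
noncomputable def tailIdeal (𝓑 : ℕ → AddSubgroup B) (s : ℕ) : TwoSidedIdeal B :=
  sInf (tailIdeals 𝓑 s)

theorem tailIdeal_eq_of_isLeast {𝓑 : ℕ → AddSubgroup B} {s : ℕ} {I : TwoSidedIdeal B}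
    (h : IsLeast (tailIdeals 𝓑 s) I) : tailIdeal 𝓑 s = I :=
  h.isGLB.sInf_eq

/-- `x` is torsion if `B_{≥ s} ^ n x = 0` for some `s, n ≥ 0`. -/
def IsTorsionElement (𝓑 : ℕ → AddSubgroup B) {M : Type u} [AddCommGroup M] [Module B M]
    (x : M) : Prop :=
  ∃ s n : ℕ, ∀ b ∈ (tailIdeal 𝓑 s).asIdeal ^ n, b • x = 0

/-- `stor-B`: the objects of `sgr-B` all of whose elements are torsion. -/
def stor (𝓑 : ℕ → AddSubgroup B) : ObjectProperty (SGr 𝓑) :=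
  fun M => ∀ x : M, IsTorsionElement 𝓑 x

end Torsion

/-! ### The quotient category and the semi-projective scheme -/

section Quotient

variable {B : Type u} [Ring B] [IsNoetherianRing B]

/-- The morphisms of `sgr-B` whose kernel and cokernel are torsion. -/
def storIso (𝓑 : ℕ → AddSubgroup B) : MorphismProperty (SGr 𝓑) :=
  fun _ _ f => stor 𝓑 (kernel f) ∧ stor 𝓑 (cokernel f)

/-- The quotient category `qsgr-B = sgr-B / stor-B`: the localization of `sgr-B` at the
morphisms whose kernel and cokernel lie in `stor-B`. -/
abbrev QSGr (𝓑 : ℕ → AddSubgroup B) : Type (u + 1) := (storIso 𝓑).Localization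

/-- The quotient functor `π : sgr-B ⥤ qsgr-B`. -/
abbrev toQSGr (𝓑 : ℕ → AddSubgroup B) : SGr 𝓑 ⥤ QSGr 𝓑 := (storIso 𝓑).Q

/-- A representative of a morphism `M ⟶ N` of the quotient category: a morphism `M' ⟶ N/N'` of
`sgr-B`, where `M' ⊆ M` with `M/M'` torsion (given by the mono `ι`) and `N' ⊆ N` is torsion
(the quotient `N/N'` is given by the epi `ρ` with kernel `N'`). -/
structure PreHom {𝓑 : ℕ → AddSubgroup B} (M N : SGr 𝓑) where
  src : SGr 𝓑
  tgt : SGr 𝓑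
  ι : src ⟶ M
  ρ : N ⟶ tgt
  mono : Mono ι
  epi : Epi ρ
  stor_cokernel : stor 𝓑 (cokernel ι)
  stor_kernel : stor 𝓑 (kernel ρ)
  f : src ⟶ tgt

namespace PreHom

variable {𝓑 : ℕ → AddSubgroup B} {M N : SGr 𝓑}

/-- `a` represents the morphism `π(ρ)⁻¹ ∘ π(f) ∘ π(ι)⁻¹` of `qsgr-B`. -/
def Represents (a : PreHom M N) (φ : (toQSGr 𝓑).obj M ⟶ (toQSGr 𝓑).obj N) : Prop :=
  (toQSGr 𝓑).map a.ι ≫ φ ≫ (toQSGr 𝓑).map a.ρ = (toQSGr 𝓑).map a.f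

/-- `a` and `b` have the same image in the direct limit of the groups `Hom(M', N/N')`: they become
equal at a third index `c`, whose subobject of `M` lies in those of `a` and `b` and whose subobject
of `N` contains those of `a` and `b`. -/
def Rel (a b : PreHom M N) : Prop :=
  ∃ (c : PreHom M N) (j : c.src ⟶ a.src) (q : a.tgt ⟶ c.tgt)
    (j' : c.src ⟶ b.src) (q' : b.tgt ⟶ c.tgt),
    j ≫ a.ι = c.ι ∧ a.ρ ≫ q = c.ρ ∧ j' ≫ b.ι = c.ι ∧ b.ρ ≫ q' = c.ρ ∧
    j ≫ a.f ≫ q = c.f ∧ j' ≫ b.f ≫ q' = c.f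

end PreHom

/-- A category together with a distinguished object. -/
structure PointedCat where
  C : Type (u + 1)
  [category : Category.{u + 1} C]
  pt : C

attribute [instance] PointedCat.category

/-- The semi-projective scheme `sproj(B) = (qsgr-B, π(B))`. -/
noncomputable def sproj (𝓑 : ℕ → AddSubgroup B) [SemiGradedRing 𝓑] : PointedCat.{u} where
  C := QSGr 𝓑
  pt := (toQSGr 𝓑).obj (regularObj 𝓑)

end Quotient

/-!
Torsion modules form a Serre subcategory because an object of `sgr-B` is finitely generated and
the ideals `B_{≥ s}` are two-sided and decrease with `s`: such a module is torsion if and only if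
a single power `B_{≥ s} ^ n` annihilates all of it (`stor_iff_exists_forall`). Closure under
subobjects and quotients is clear. In an extension of a module killed by `B_{≥ s} ^ n` by a module
killed by `B_{≥ t} ^ m`, everything is killed by the product `B_{≥ t} ^ m * B_{≥ s} ^ n`, which
contains `B_{≥ max s t} ^ (m + n)` (`stor_of_extension`).

The class of morphisms with torsion kernel and cokernel is then `(stor 𝓑).isoModSerre`, so it has
a left and a right calculus of fractions and the localization is abelian, with additive `π`, by
Mathlib's theorem on localizations at Serre classes.

The description of the morphisms as a direct limit has three parts. A morphism `M' ⟶ N/N'`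
represents exactly one morphism `π M ⟶ π N`, because `π` inverts `M' ⟶ M` and `N ⟶ N/N'`. Every
morphism `π M ⟶ π N` is a right fraction `M ⟵ X ⟶ N`; replacing `X` by its image in `M`, and `N`
by its quotient by the image of the kernel of `X ⟶ M`, gives a representative
(`PreHom.exists_represents`). Finally, if two representatives define the same morphism, `π` kills
their difference `d`, restricted to a common subobject and projected to a common quotient. So the
image of `d` is torsion, and after dividing by it the two become equal
(`PreHom.rel_of_represents`).
-/

/-! ### Torsion modules are uniformly annihilated -/

section Torsion

variable {B : Type u} [Ring B] {𝓑 : ℕ → AddSubgroup B}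

/-- The smaller `s`, the stronger the condition of containing `⨁_{p ≥ s} Bₚ`, so the ideals
`B_{≥ s}` decrease with `s`. -/
theorem tailIdeal_antitone (𝓑 : ℕ → AddSubgroup B) : Antitone (tailIdeal 𝓑) := fun _ _ hst =>
  sInf_le_sInf fun _ hI => ⟨(biSup_mono fun _ hp => hst.trans hp).trans hI.1, hI.2⟩

theorem tailIdeal_pow_le {s t m n : ℕ} (hst : s ≤ t) (hmn : m ≤ n) :
    (tailIdeal 𝓑 t).asIdeal ^ n ≤ (tailIdeal 𝓑 s).asIdeal ^ m :=
  (Ideal.pow_right_mono (TwoSidedIdeal.asIdeal.monotone (tailIdeal_antitone 𝓑 hst)) n).trans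
    (Ideal.pow_le_pow_right hmn)

/-- On a finitely generated module one power of one `B_{≥ s}` annihilates everything: take the
largest exponents needed for the generators. The ideal being two-sided, annihilating the
generators is enough. -/
theorem stor_iff_exists_forall (M : SGr 𝓑) :
    stor 𝓑 M ↔ ∃ s n : ℕ, ∀ b ∈ (tailIdeal 𝓑 s).asIdeal ^ n, ∀ x : M, b • x = 0 := by
  refine ⟨fun hM => ?_, fun ⟨s, n, h⟩ x => ⟨s, n, fun b hb => h b hb x⟩⟩
  obtain ⟨S, hS⟩ := (Module.Finite.fg_top : (⊤ : Submodule B M).FG)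
  choose s n h using hM
  refine ⟨S.sup s, S.sup n, fun b hb x => ?_⟩
  have hx : x ∈ Submodule.span B (S : Set M) := hS ▸ Submodule.mem_top
  induction hx using Submodule.span_induction generalizing b with
  | mem y hy =>
    exact h y b (tailIdeal_pow_le (Finset.le_sup (f := s) hy) (Finset.le_sup (f := n) hy) hb)
  | zero => exact smul_zero b
  | add y z _ _ hy hz => rw [smul_add, hy b hb, hz b hb, add_zero]
  | smul r y _ hy => rw [smul_smul, hy _ (Ideal.mul_mem_right r _ hb)]

/-- If `I = B_{≥ s}` satisfies `Iⁿ X₃ = 0` and `J = B_{≥ t}` satisfies `Jᵐ X₁ = 0`, then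
`Jᵐ Iⁿ X₂ = 0` in an extension `X₂` of `X₃` by `X₁`. -/
theorem stor_of_extension {X₁ X₂ X₃ : SGr 𝓑} (f : X₁ ⟶ X₂) (g : X₂ ⟶ X₃)
    (hfg : ∀ x, SGr.Hom.lin g x = 0 → ∃ a, SGr.Hom.lin f a = x)
    (h₁ : stor 𝓑 X₁) (h₃ : stor 𝓑 X₃) : stor 𝓑 X₂ := by
  rw [stor_iff_exists_forall] at h₁ h₃ ⊢
  obtain ⟨t, m, h₁⟩ := h₁
  obtain ⟨s, n, h₃⟩ := h₃
  refine ⟨max s t, m + n, fun b hb x => ?_⟩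
  have hle : (tailIdeal 𝓑 (max s t)).asIdeal ^ (m + n) ≤
      (tailIdeal 𝓑 t).asIdeal ^ m * (tailIdeal 𝓑 s).asIdeal ^ n := by
    rw [Ideal.IsTwoSided.pow_add]
    exact Ideal.mul_mono (tailIdeal_pow_le (le_max_right s t) le_rfl)
      (tailIdeal_pow_le (le_max_left s t) le_rfl)
  replace hb := hle hb
  clear hle
  induction hb using Submodule.smul_induction_on' with
  | smul c hc d hd =>
    obtain ⟨a, ha⟩ := hfg (d • x) (by rw [map_smul, h₃ d hd])
    rw [smul_eq_mul, mul_smul, ← ha, ← map_smul, h₁ c hc, map_zero]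
  | add c _ d _ hc hd => rw [add_smul, hc, hd, add_zero]

theorem stor_of_injective {X Y : SGr 𝓑} (f : X ⟶ Y) (hf : Function.Injective (SGr.Hom.lin f))
    (hY : stor 𝓑 Y) : stor 𝓑 X := fun x => by
  obtain ⟨s, n, h⟩ := hY (SGr.Hom.lin f x)
  exact ⟨s, n, fun b hb => hf (by rw [map_smul, h b hb, map_zero])⟩

theorem stor_of_surjective {X Y : SGr 𝓑} (f : X ⟶ Y) (hf : Function.Surjective (SGr.Hom.lin f))
    (hX : stor 𝓑 X) : stor 𝓑 Y := fun y => by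
  obtain ⟨x, rfl⟩ := hf y
  obtain ⟨s, n, h⟩ := hX x
  exact ⟨s, n, fun b hb => by rw [← map_smul, h b hb, map_zero]⟩

end Torsion

/-! ### The Serre class of torsion modules -/

section Quotient

open ObjectProperty

variable {B : Type u} [Ring B] [IsNoetherianRing B] {𝓑 : ℕ → AddSubgroup B}

instance stor_isSerreClass (𝓑 : ℕ → AddSubgroup B) : (stor 𝓑).IsSerreClass where
  exists_zero := by
    refine ⟨SGr.zeroObj 𝓑, ?_, fun x => ⟨0, 0, fun b _ => rfl⟩⟩
    rw [IsZero.iff_id_eq_zero]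
    ext x
    rfl
  prop_of_mono f _ hY := stor_of_injective f (SGr.injective_of_mono f) hY
  prop_of_epi f _ hX := stor_of_surjective f (SGr.surjective_of_epi f) hX
  prop_X₂_of_shortExact {S} hS h₁ h₃ := by
    refine stor_of_extension S.f S.g (fun x hx => ?_) h₁ h₃
    have := hS.mono_f
    have hl := hS.exact.lift_f (SGr.kerι S.g) (SGr.kerι_comp S.g)
    exact ⟨_, LinearMap.congr_fun (congrArg SGr.Hom.lin hl)
      (⟨x, hx⟩ : LinearMap.ker (SGr.Hom.lin S.g))⟩

instance toQSGr_isLocalization (𝓑 : ℕ → AddSubgroup B) :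
    (toQSGr 𝓑).IsLocalization (stor 𝓑).isoModSerre :=
  inferInstanceAs ((storIso 𝓑).Q.IsLocalization (storIso 𝓑))

/-- The additive structure which the calculus of fractions puts on `qsgr-B`. It is not an instance,
so that it does not compete with the structure underlying a given abelian structure. -/
@[reducible] noncomputable def qsgrPreadditive (𝓑 : ℕ → AddSubgroup B) :
    Preadditive (QSGr 𝓑) :=
  Localization.preadditive (toQSGr 𝓑) (stor 𝓑).isoModSerre

theorem toQSGr_additive (𝓑 : ℕ → AddSubgroup B) :
    letI := qsgrPreadditive 𝓑
    (toQSGr 𝓑).Additive :=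
  Localization.functor_additive (toQSGr 𝓑) (stor 𝓑).isoModSerre

/-- The abelian structure on `qsgr-B` which extends `qsgrPreadditive`. -/
@[reducible] noncomputable def qsgrAbelian (𝓑 : ℕ → AddSubgroup B) : Abelian (QSGr 𝓑) :=
  letI := qsgrPreadditive 𝓑
  haveI := toQSGr_additive 𝓑
  SerreClassLocalization.abelian (toQSGr 𝓑) (stor 𝓑)

/-! ### Morphisms of the quotient category -/

namespace PreHom

variable {M N : SGr 𝓑}

theorem isoModSerre_ι (a : PreHom M N) : (stor 𝓑).isoModSerre a.ι :=
  have := a.mono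
  isoModSerre_of_mono _ _ a.stor_cokernel

theorem isoModSerre_ρ (a : PreHom M N) : (stor 𝓑).isoModSerre a.ρ :=
  have := a.epi
  isoModSerre_of_epi _ _ a.stor_kernel

instance (a : PreHom M N) : IsIso ((toQSGr 𝓑).map a.ι) :=
  Localization.inverts _ (stor 𝓑).isoModSerre _ a.isoModSerre_ι

instance (a : PreHom M N) : IsIso ((toQSGr 𝓑).map a.ρ) :=
  Localization.inverts _ (stor 𝓑).isoModSerre _ a.isoModSerre_ρ

theorem existsUnique_represents (a : PreHom M N) : ∃! φ, a.Represents φ :=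
  ⟨inv ((toQSGr 𝓑).map a.ι) ≫ (toQSGr 𝓑).map a.f ≫ inv ((toQSGr 𝓑).map a.ρ),
    by simp [Represents], fun φ (h : _ = _) => by simp [← h]⟩

/-- A right fraction `M ⟵ X ⟶ N`, with denominator `s` and numerator `f`, induces a morphism
from the image of `s` to the quotient of `N` by the torsion subobject `f (ker s)`. -/
theorem exists_represents (φ : (toQSGr 𝓑).obj M ⟶ (toQSGr 𝓑).obj N) :
    ∃ a : PreHom M N, a.Represents φ := by
  obtain ⟨z, hz⟩ := Localization.exists_rightFraction (toQSGr 𝓑) (stor 𝓑).isoModSerre φ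
  let e := Abelian.factorThruImage z.s
  let k := kernel.ι z.s ≫ z.f
  have hfac : e ≫ Abelian.image.ι z.s = z.s := Abelian.image.fac z.s
  have he : kernel.ι e ≫ z.f ≫ cokernel.π k = 0 := by
    have h : kernel.ι e ≫ z.s = 0 := by
      have h := kernel.condition_assoc e (Abelian.image.ι z.s)
      rwa [hfac, zero_comp] at h
    rw [← kernel.lift_ι z.s (kernel.ι e) h, Category.assoc, ← Category.assoc _ z.f,
      cokernel.condition, comp_zero]
  have hs : (stor 𝓑).isoModSerre (Abelian.image.ι z.s) := z.hs.2.isoModSerre_image_ι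
  -- The kernel of `cokernel.π k` is the image of `k`, which is a quotient of `ker s`.
  have hk : stor 𝓑 (Abelian.image k) := prop_of_epi _ (Abelian.factorThruImage k) z.hs.1
  refine ⟨{ src := _
            tgt := _
            ι := Abelian.image.ι z.s
            ρ := cokernel.π k
            mono := inferInstance
            epi := inferInstance
            stor_cokernel := hs.2
            stor_kernel := hk
            f := Abelian.epiDesc e (z.f ≫ cokernel.π k) he }, ?_⟩
  have : IsIso ((toQSGr 𝓑).map e) :=
    Localization.inverts _ (stor 𝓑).isoModSerre _ z.hs.1.isoModSerre_factorThruImage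
  rw [Represents, ← cancel_epi ((toQSGr 𝓑).map e), ← Functor.map_comp, Abelian.comp_epiDesc,
    ← Category.assoc, ← Functor.map_comp, hfac, hz, Functor.map_comp,
    MorphismProperty.RightFraction.map_s_comp_map_assoc]

/-- Passing to a later index of the direct system does not change the represented morphism. -/
theorem Represents.of_later {a c : PreHom M N} {φ : (toQSGr 𝓑).obj M ⟶ (toQSGr 𝓑).obj N}
    (h : a.Represents φ) {j : c.src ⟶ a.src} {q : a.tgt ⟶ c.tgt}
    (hj : j ≫ a.ι = c.ι) (hq : a.ρ ≫ q = c.ρ) (hf : j ≫ a.f ≫ q = c.f) : c.Represents φ := by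
  rw [Represents] at h
  simp only [Represents, ← hj, ← hq, ← hf, Functor.map_comp, Category.assoc, ← h]

/-- Let `d` be the difference of `a.f` and `b.f`, restricted to the intersection of their sources
and projected to the sum of the quotients. If `a` and `b` represent the same morphism, the
image of `d` is torsion, so it may be divided out. -/
theorem rel_of_represents {a b : PreHom M N} {φ : (toQSGr 𝓑).obj M ⟶ (toQSGr 𝓑).obj N}
    (ha : a.Represents φ) (hb : b.Represents φ) : a.Rel b := by
  have := a.mono
  have := b.mono
  have := a.epi
  have := b.epi
  let := qsgrPreadditive 𝓑
  have := toQSGr_additive 𝓑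
  have ha' := ha
  have hb' := hb
  rw [Represents] at ha' hb'
  let d := pullback.fst a.ι b.ι ≫ a.f ≫ pushout.inl a.ρ b.ρ -
    pullback.snd a.ι b.ι ≫ b.f ≫ pushout.inr a.ρ b.ρ
  have hd : (toQSGr 𝓑).map d = 0 := by
    have h₁ := congrArg (toQSGr 𝓑).map (pullback.condition (f := a.ι) (g := b.ι))
    have h₂ := congrArg (toQSGr 𝓑).map (pushout.condition (f := a.ρ) (g := b.ρ))
    simp only [Functor.map_comp] at h₁ h₂
    simp only [d, Functor.map_sub, Functor.map_comp, ← ha', ← hb', Category.assoc]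
    rw [reassoc_of% h₁, h₂, sub_self]
  have hd' : stor 𝓑 (Abelian.image d) :=
    (SerreClassLocalization.map_eq_zero_iff (toQSGr 𝓑) (stor 𝓑) d).1 hd
  have hι : (stor 𝓑).isoModSerre (pullback.fst a.ι b.ι ≫ a.ι) :=
    MorphismProperty.comp_mem _ _ _
      (MorphismProperty.pullback_fst _ _ b.isoModSerre_ι) a.isoModSerre_ι
  have hρ : (stor 𝓑).isoModSerre (a.ρ ≫ pushout.inl a.ρ b.ρ ≫ cokernel.π d) :=
    MorphismProperty.comp_mem _ _ _ a.isoModSerre_ρ (MorphismProperty.comp_mem _ _ _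
      (MorphismProperty.pushout_inl _ _ b.isoModSerre_ρ) (isoModSerre_of_epi _ _ hd'))
  refine ⟨{ src := _
            tgt := _
            ι := pullback.fst a.ι b.ι ≫ a.ι
            ρ := a.ρ ≫ pushout.inl a.ρ b.ρ ≫ cokernel.π d
            mono := inferInstance
            epi := inferInstance
            stor_cokernel := hι.2
            stor_kernel := hρ.1
            f := pullback.fst a.ι b.ι ≫ a.f ≫ pushout.inl a.ρ b.ρ ≫ cokernel.π d },
    pullback.fst a.ι b.ι, pushout.inl a.ρ b.ρ ≫ cokernel.π d,
    pullback.snd a.ι b.ι, pushout.inr a.ρ b.ρ ≫ cokernel.π d,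
    rfl, rfl, pullback.condition.symm, pushout.condition_assoc _ |>.symm, rfl, ?_⟩
  have h := cokernel.condition d
  simp only [d, Preadditive.sub_comp, Category.assoc, sub_eq_zero] at h
  exact h.symm

theorem eq_iff_rel {a b : PreHom M N} {φ ψ : (toQSGr 𝓑).obj M ⟶ (toQSGr 𝓑).obj N}
    (ha : a.Represents φ) (hb : b.Represents ψ) : φ = ψ ↔ a.Rel b := by
  constructor
  · rintro rfl
    exact rel_of_represents ha hb
  · rintro ⟨c, j, q, j', q', hj, hq, hj', hq', hf, hf'⟩
    exact c.existsUnique_represents.unique (ha.of_later hj hq hf) (hb.of_later hj' hq' hf')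

end PreHom

end Quotient

theorem theorem16p6p5 {B : Type u} [Ring B] [IsNoetherianRing B]
    (𝓑 : ℕ → AddSubgroup B) [SemiGradedRing 𝓑] :
    (stor 𝓑).IsSerreClass ∧
    (∃ _ : Abelian (QSGr 𝓑), (toQSGr 𝓑).Additive) ∧
    Function.Bijective (toQSGr 𝓑).obj ∧
    (∀ M N : SGr 𝓑,
      (∀ a : PreHom M N, ∃! φ, a.Represents φ) ∧
      (∀ φ, ∃ a : PreHom M N, a.Represents φ) ∧
      (∀ (a b : PreHom M N) (φ ψ), a.Represents φ → b.Represents ψ → (φ = ψ ↔ a.Rel b))) ∧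
    Nonempty (Abelian (sproj 𝓑).C) :=
  ⟨inferInstance, ⟨qsgrAbelian 𝓑, toQSGr_additive 𝓑⟩,
    (Localization.Construction.objEquiv (storIso 𝓑)).bijective,
    fun _ _ => ⟨PreHom.existsUnique_represents, PreHom.exists_represents,
      fun _ _ _ _ => PreHom.eq_iff_rel⟩,
    ⟨qsgrAbelian 𝓑⟩⟩
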